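/- Let $\mathcal N=\{1,\dots,N\}$ be a set of goods and $\mathcal K=\{1,\dots,K\}$, $K\ge 1$, a set of agents. Agent $j$ has a family $\mathcal A_j\subseteq 2^{\mathcal N}$ of feasible bundles with $\emptyset\in\mathcal A_j$, and a reward function $r^j:\mathbb R^N\times\mathcal A_j\to\mathbb R$. Let $\mathcal M$ be the set of allocations, i.e. of maps $\phi$ on $\mathcal K$ with $\phi(j)\in\mathcal A_j$ for all $j$ and $\phi(i)\cap\phi(j)=\emptyset$ for $i\ne j$. Let $\boldsymbol\mu\in\mathbb R^N$ be the vector of unknown true qualities, $\mathrm{opt}=\max_{\phi\in\mathcal M}\min_{j\in\mathcal K} r^j(\boldsymbol\mu;\phi(j))$, and $\Phi^*=\{\phi\in\mathcal M:\min_{j} r^j(\boldsymbol\mu;\phi(j))=\mathrm{opt}\}$. Let $\alpha>2$, $\sigma>0$, $c>0$, $\tilde\Delta_{\min}>0$ and $\tilde\Delta_{\max}\in\mathbb R$ be constants such that: (i) for all $j\in\mathcal K$, $S\in\mathcal A_j$ and $x,y\in\mathbb R^N$: $|r^j(x;S)-r^j(y;S)|\le c\sum_{i\in S}|x_i-y_i|$,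 and $r^j(x;S)\le r^j(y;S)$ whenever $x_i\le y_i$ for all $i\in S$; (ii) $\min_{j} r^j(\boldsymbol\mu;\phi_1(j))-\min_{j} r^j(\boldsymbol\mu;\phi_2(j))>\tilde\Delta_{\min}$ for all $\phi_1\in\Phi^*$ and $\phi_2\in\mathcal M\setminus\Phi^*$; (iii) $|r^j(\boldsymbol\mu;\phi_1(j))-r^i(\boldsymbol\mu;\phi_2(i))|\le\tilde\Delta_{\max}$ for all $\phi_1,\phi_2\in\mathcal M$ and all $i\neq j$ in $\mathcal K$ (if $K=1$: also for $i=j$). The signal on good $i$ in round $t=1,2,\dots$ is $X_i(t)=\mu_i+\epsilon_i(t)$, where the noise vectors $(\epsilon_1(t),\dots,\epsilon_N(t))$ are independent across $t$ and each $\epsilon_i(t)$ is $\sigma^2$-subgaussian, i.e. $\mathbb E\,e^{\lambda\epsilon_i(t)}\le e^{\sigma^2\lambda^2/2}$ for all $\lambda\in\mathbb R$. Dueling Max-Min ULCB algorithm. In round $t\le N$ it observes the signal $X_t(t)$ on good $t$, while an arbitrary predetermined allocation $\phi_t\in\mathcal M$ is in force. In round $t>N$, let $T_i(t-1)$ be the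 number of signals on good $i$ observed in the rounds before $t$ and $\hat\mu_i$ their average, and put $$\bar\nu_i(t)=\hat\mu_i+\sqrt{\tfrac{2\sigma^2\log t^{\alpha}}{T_i(t-1)}},\qquad \underline\nu_i(t)=\hat\mu_i-\sqrt{\tfrac{2\sigma^2\log t^{\alpha}}{T_i(t-1)}} .$$ The algorithm chooses $\phi_t=\mathcal O_1(\bar{\boldsymbol\nu}(t))\in\arg\max_{\phi\in\mathcal M}\min_j r^j(\bar{\boldsymbol\nu}(t);\phi(j))$ and $j_t=\mathcal O_2(\underline{\boldsymbol\nu}(t),\phi_t)\in\arg\min_j r^j(\underline{\boldsymbol\nu}(t);\phi_t(j))$, and observes the signals $X_i(t)$ for $i\in\phi_t(j_t)$ only. Here $\mathcal O_1,\mathcal O_2$ are any (measurable) oracles that return such a maximizer, respectively minimizer. Then, for every horizon $T$, the expected cumulative regret $R_T=\mathbb E\left[\sum_{t=1}^{T}\left(\mathrm{opt}-\min_{j\in\mathcal K} r^j(\boldsymbol\mu;\phi_t(j))\right)\right]$ is well defined and satisfies $$R_T\le 3\,\tilde\Delta_{\max}\,N\left[\frac{(\sqrt{2\alpha}+2)^2c^2N^2\sigma^2}{\tilde\Delta_{\min}^2}\,\log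 T+\frac{\alpha-1}{\alpha-2}+2\right]$$ (with the convention $\log 0=0$ when $T=0$). -/

import Mathlib

open MeasureTheory ProbabilityTheory

noncomputable section

namespace BundleBandit

/-- An allocation of pairwise disjoint bundles of the goods `Fin N` to the agents `Fin K`, where
`A j` is the set of feasible bundles of agent `j`. -/
def Allocation {K N : ℕ} (A : Fin K → Set (Finset (Fin N))) : Type :=
  {φ : Fin K → Finset (Fin N) // (∀ j, φ j ∈ A j) ∧ ∀ i j, i ≠ j → Disjoint (φ i) (φ j)}

/-- The (finite) set of allocations carries the discrete σ-algebra. -/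
instance {K N : ℕ} (A : Fin K → Set (Finset (Fin N))) : MeasurableSpace (Allocation A) := ⊤

variable {K N : ℕ} {A : Fin K → Set (Finset (Fin N))}

/-- The least reward `min_j r^j(x; φ(j))` of an allocation when the qualities of the goods
are `x`. -/
def minReward (r : Fin K → (Fin N → ℝ) → Finset (Fin N) → ℝ) (x : Fin N → ℝ)
    (φ : Allocation A) : ℝ :=
  ⨅ j, r j x (φ.1 j)

/-- The max-min value `max_φ min_j r^j(x; φ(j))`. -/
def optMaxMin (A : Fin K → Set (Finset (Fin N)))
    (r : Fin K → (Fin N → ℝ) → Finset (Fin N) → ℝ) (x : Fin N → ℝ) : ℝ :=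
  ⨆ φ : Allocation A, minReward r x φ

/-- The set of max-min optimal allocations. -/
def optimalAllocations (A : Fin K → Set (Finset (Fin N)))
    (r : Fin K → (Fin N → ℝ) → Finset (Fin N) → ℝ) (x : Fin N → ℝ) : Set (Allocation A) :=
  {φ | minReward r x φ = optMaxMin A r x}

/-- On its feasible bundles, every agent's reward is `c`-Lipschitz in the qualities of the goods in
the bundle, and monotone in them. -/
def LipschitzMonotone (A : Fin K → Set (Finset (Fin N)))
    (r : Fin K → (Fin N → ℝ) → Finset (Fin N) → ℝ) (c : ℝ) : Prop :=
  ∀ j, ∀ S ∈ A j, ∀ x y : Fin N → ℝ,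
    |r j x S - r j y S| ≤ c * ∑ i ∈ S, |x i - y i| ∧
    ((∀ i ∈ S, x i ≤ y i) → r j x S ≤ r j y S)

/-- The max-min value of an optimal allocation exceeds that of a suboptimal one by more
than `Δmin`. -/
def MinGap (A : Fin K → Set (Finset (Fin N)))
    (r : Fin K → (Fin N → ℝ) → Finset (Fin N) → ℝ) (x : Fin N → ℝ) (Δmin : ℝ) : Prop :=
  ∀ φ₁ ∈ optimalAllocations A r x, ∀ φ₂ ∉ optimalAllocations A r x,
    Δmin < minReward r x φ₁ - minReward r x φ₂

/-- The rewards of two distinct agents, in any two allocations, differ by at most `Δmax`. If there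
is only one agent, its rewards in any two allocations differ by at most `Δmax`. -/
def MaxGap (A : Fin K → Set (Finset (Fin N)))
    (r : Fin K → (Fin N → ℝ) → Finset (Fin N) → ℝ) (x : Fin N → ℝ) (Δmax : ℝ) : Prop :=
  ∀ φ₁ φ₂ : Allocation A, ∀ i j : Fin K, (i ≠ j ∨ K = 1) →
    |r j x (φ₁.1 j) - r i x (φ₂.1 i)| ≤ Δmax

/-- First oracle: maps a vector of qualities to a max-min allocation for these qualities. -/
def IsMaxMinOracle (r : Fin K → (Fin N → ℝ) → Finset (Fin N) → ℝ)
    (O₁ : (Fin N → ℝ) → Allocation A) : Prop :=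
  ∀ x, ∀ φ : Allocation A, minReward r x φ ≤ minReward r x (O₁ x)

/-- Second oracle: maps a vector of qualities and an allocation to an agent with the lowest
reward. -/
def IsMinAgentOracle (r : Fin K → (Fin N → ℝ) → Finset (Fin N) → ℝ)
    (O₂ : (Fin N → ℝ) → Allocation A → Fin K) : Prop :=
  ∀ x, ∀ φ : Allocation A, ∀ j, r (O₂ x φ) x (φ.1 (O₂ x φ)) ≤ r j x (φ.1 j)

/-- What the algorithm remembers: for each good, how many signals on its quality have been observed
and their sum. -/
structure Record (N : ℕ) where
  count : Fin N → ℕ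
  total : Fin N → ℝ

/-- Record the signals `x i` on the goods `i ∈ S`. -/
def Record.observe (s : Record N) (S : Finset (Fin N)) (x : Fin N → ℝ) : Record N where
  count i := if i ∈ S then s.count i + 1 else s.count i
  total i := if i ∈ S then s.total i + x i else s.total i

/-- The empirical mean of the observed signals on good `i`. -/
def Record.mean (s : Record N) (i : Fin N) : ℝ := s.total i / s.count i

/-- The confidence radius for good `i` in round `t`. -/
def Record.radius (s : Record N) (σ α : ℝ) (t : ℕ) (i : Fin N) : ℝ :=
  √(1 / (s.count i : ℝ) * (2 * σ ^ 2 * Real.log ((t : ℝ) ^ α)))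

/-- The vector of upper confidence bounds in round `t`. -/
def Record.ucb (s : Record N) (σ α : ℝ) (t : ℕ) (i : Fin N) : ℝ := s.mean i + s.radius σ α t i

/-- The vector of lower confidence bounds in round `t`. -/
def Record.lcb (s : Record N) (σ α : ℝ) (t : ℕ) (i : Fin N) : ℝ := s.mean i - s.radius σ α t i

section Algorithm

/- `start t` is the allocation in force in the exploration round `t ≤ N`, and `s` is always the
record of the rounds before round `t`. Rounds are numbered from `1`. -/
variable (σ α : ℝ) (O₁ : (Fin N → ℝ) → Allocation A) (O₂ : (Fin N → ℝ) → Allocation A → Fin K)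
  (start : ℕ → Allocation A)

/-- The allocation chosen in round `t`: after the first `N` rounds, the max-min allocation for the
upper confidence bounds. -/
def chooseAllocation (t : ℕ) (s : Record N) : Allocation A :=
  if t ≤ N then start t else O₁ (s.ucb σ α t)

/-- The goods on which signals are observed in round `t`: the `t`-th good in the first `N` rounds;
afterwards the bundle, in the max-min allocation for the upper confidence bounds, of the agent with
the lowest reward for the lower confidence bounds. -/
def chooseFeedback (t : ℕ) (s : Record N) : Finset (Fin N) :=
  if t ≤ N then Finset.univ.filter (fun i : Fin N => i.val + 1 = t)
  else (O₁ (s.ucb σ α t)).1 (O₂ (s.lcb σ α t) (O₁ (s.ucb σ α t)))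

/-- The record after round `t`, when `X t i` is the signal on good `i` available in round `t`. -/
def recordAfter (X : ℕ → Fin N → ℝ) : ℕ → Record N
  | 0 => ⟨fun _ => 0, fun _ => 0⟩
  | t + 1 =>
      (recordAfter X t).observe (chooseFeedback σ α O₁ O₂ (t + 1) (recordAfter X t)) (X (t + 1))

/-- The allocation of the Dueling Max-Min ULCB algorithm in round `t ≥ 1`. -/
def duelingAllocation (X : ℕ → Fin N → ℝ) (t : ℕ) : Allocation A :=
  chooseAllocation σ α O₁ start t (recordAfter σ α O₁ O₂ X (t - 1))

/-- The regret accumulated in the rounds `1, …, T` along the signals `X`, where `μ` are the true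
qualities. Its expectation is the expected cumulative regret. -/
def pathRegret (r : Fin K → (Fin N → ℝ) → Finset (Fin N) → ℝ) (μ : Fin N → ℝ)
    (X : ℕ → Fin N → ℝ) (T : ℕ) : ℝ :=
  ∑ t ∈ Finset.Icc 1 T,
    (optMaxMin A r μ - minReward r μ (duelingAllocation σ α O₁ O₂ start X t))

end Algorithm

end BundleBandit

end

open BundleBandit

namespace BundleBandit

/-! Only suboptimal rounds cost anything, and each costs at most `Δmax`, so it suffices to count
them. The `N` exploration rounds are conceded. A later round is bad luck if some true quality
exceeds its upper bound, or some mean exceeds its true quality by more than the radius with exponent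
`p = min α 4`. An exponential supermartingale and a union bound over the possible counts give each
kind probability at most `N * t ^ (1 - p')` in round `t`, with `p' = α` or `p`; this is summable
because `p' > 2` (`measureReal_exists_deviation_le`, `sum_rpow_le`).

In the remaining suboptimal rounds the upper estimate `u` and the lower estimate `l` enclose the
truth. By optimism every agent's bundle is worth at least the optimum under `u`; the observed agent
is worth at most the true minimum under `l`. Hence the confidence widths on the observed bundle sum
to more than `Δmin / c` (`gap_lt_of_suboptimal`). Every such round raises the counts of all goods in
that bundle, so this cannot happen often.

The constant needs two counts (`card_suboptimal_le`). For large `N`, summing the widths over rounds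
and goods gives order `N ^ 2` rounds, below the claimed `N ^ 3` (`card_le_of_lt_sum`). For small
`N`, some good in the bundle has a small count, and the pigeonhole principle applies
(`card_le_of_exists_count_lt`). There the full width `u - l` is too lossy, but either the observed
agent truly attains the minimum and the one-sided width suffices, or another agent holds a good and
the bundle has at most `N - 1` elements. -/

instance {K N : ℕ} (A : Fin K → Set (Finset (Fin N))) : Finite (Allocation A) :=
  Subtype.finite

instance {K N : ℕ} (A : Fin K → Set (Finset (Fin N))) : DiscreteMeasurableSpace (Allocation A) :=
  ⟨fun _ => trivial⟩

/-! ### Optimism, pessimism and the gap. -/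

section Rewards

variable {K N : ℕ} {A : Fin K → Set (Finset (Fin N))}
  {r : Fin K → (Fin N → ℝ) → Finset (Fin N) → ℝ}

lemma minReward_le (x : Fin N → ℝ) (φ : Allocation A) (j : Fin K) :
    minReward r x φ ≤ r j x (φ.1 j) :=
  ciInf_le (Set.finite_range _).bddBelow j

lemma exists_eq_minReward (hK : 1 ≤ K) (x : Fin N → ℝ) (φ : Allocation A) :
    ∃ j, r j x (φ.1 j) = minReward r x φ :=
  have : Nonempty (Fin K) := ⟨⟨0, hK⟩⟩
  exists_eq_ciInf_of_finite

lemma le_minReward (hK : 1 ≤ K) {x : Fin N → ℝ} {φ : Allocation A} {a : ℝ}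
    (h : ∀ j, a ≤ r j x (φ.1 j)) : a ≤ minReward r x φ := by
  obtain ⟨j, hj⟩ := exists_eq_minReward (r := r) hK x φ
  exact hj ▸ h j

lemma nonempty_allocation (hA : ∀ j, ∅ ∈ A j) : Nonempty (Allocation A) :=
  ⟨⟨fun _ => ∅, hA, fun _ _ _ => Finset.disjoint_empty_left _⟩⟩

lemma exists_optimal (hA : ∀ j, ∅ ∈ A j) (x : Fin N → ℝ) :
    ∃ φ : Allocation A, φ ∈ optimalAllocations A r x :=
  have := nonempty_allocation hA
  exists_eq_ciSup_of_finite

/-- A single round costs at most `Δmax`. -/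
lemma optMaxMin_sub_minReward_le (hK : 1 ≤ K) (hA : ∀ j, ∅ ∈ A j) {x : Fin N → ℝ} {Δmax : ℝ}
    (hmax : MaxGap A r x Δmax) (φ : Allocation A) :
    optMaxMin A r x - minReward r x φ ≤ Δmax := by
  obtain ⟨ψ, hψ⟩ := exists_optimal (r := r) hA x
  obtain ⟨i, hi⟩ := exists_eq_minReward (r := r) hK x φ
  -- The optimum is at most the reward of every agent under `ψ`, so the agent compared with `i` may
  -- be chosen freely, in particular distinct from `i`.
  obtain ⟨j, hj⟩ : ∃ j : Fin K, i ≠ j ∨ K = 1 := by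
    rcases hK.eq_or_lt with h | h
    · exact ⟨i, Or.inr h.symm⟩
    · have : Nontrivial (Fin K) := Fin.nontrivial_iff_two_le.2 h
      obtain ⟨j, hj⟩ := exists_ne i
      exact ⟨j, Or.inl hj.symm⟩
  have h1 := (le_abs_self _).trans (hmax ψ φ i j hj)
  have h2 := minReward_le (r := r) x ψ j
  have h3 : minReward r x ψ = optMaxMin A r x := hψ
  linarith

lemma maxGap_nonneg (hK : 1 ≤ K) (hA : ∀ j, ∅ ∈ A j) {x : Fin N → ℝ} {Δmax : ℝ}
    (hmax : MaxGap A r x Δmax) : 0 ≤ Δmax := by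
  obtain ⟨ψ, hψ⟩ := exists_optimal (r := r) hA x
  have h := optMaxMin_sub_minReward_le hK hA hmax ψ
  have h3 : minReward r x ψ = optMaxMin A r x := hψ
  linarith

/-- If a suboptimal allocation is chosen from an upper estimate `u` of the qualities `x`, then the
width between `u` and the lower estimate `l` on the observed bundle exceeds the gap. Moreover,
either the width between `u` and `x` alone exceeds it, or the bundle does not contain all goods. -/
lemma gap_lt_of_suboptimal (hK : 1 ≤ K) (hA : ∀ j, ∅ ∈ A j) {c Δmin : ℝ}
    (hΔ : 0 < Δmin) (hr : LipschitzMonotone A r c) {x u l : Fin N → ℝ} (hmin : MinGap A r x Δmin)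
    {O₁ : (Fin N → ℝ) → Allocation A} (hO₁ : IsMaxMinOracle r O₁)
    {O₂ : (Fin N → ℝ) → Allocation A → Fin K} (hO₂ : IsMinAgentOracle r O₂)
    (hu : ∀ i, x i ≤ u i) (hl : ∀ i, l i ≤ x i) (hbad : O₁ u ∉ optimalAllocations A r x) :
    Δmin < c * ∑ i ∈ (O₁ u).1 (O₂ l (O₁ u)), (u i - l i) ∧
    (Δmin < c * ∑ i ∈ (O₁ u).1 (O₂ l (O₁ u)), (u i - x i) ∨
      ((O₁ u).1 (O₂ l (O₁ u))).card + 1 ≤ N) := by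
  set φ := O₁ u with hφ
  set j := O₂ l φ with hj
  obtain ⟨ψ, hψ⟩ := exists_optimal (r := r) hA x
  have hψ' : minReward r x ψ = optMaxMin A r x := hψ
  obtain ⟨j', hj'⟩ := exists_eq_minReward (r := r) hK x φ
  have hgap := hmin ψ hψ φ hbad
  -- Optimism: raising the qualities from `x` to `u` does not lower the value of `ψ`, and `φ` is the
  -- maximizer at `u`.
  have hopt : ∀ k, minReward r x ψ ≤ r k u (φ.1 k) := fun k => by
    refine le_trans ?_ ((hO₁ u ψ).trans (minReward_le u φ k))
    exact le_minReward hK fun m => (minReward_le x ψ m).trans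
      ((hr m _ (ψ.2.1 m) x u).2 fun i _ => hu i)
  have habs : ∀ v : Fin N → ℝ, (∀ i, v i ≤ u i) →
      r j u (φ.1 j) - r j v (φ.1 j) ≤ c * ∑ i ∈ φ.1 j, (u i - v i) := fun v hv => by
    refine (le_abs_self _).trans ((hr j _ (φ.2.1 j) u v).1.trans_eq ?_)
    congr 1
    exact Finset.sum_congr rfl fun i _ => abs_of_nonneg (sub_nonneg.2 (hv i))
  constructor
  · have h1 : r j l (φ.1 j) ≤ minReward r x φ := by
      rw [← hj']
      exact (hO₂ l φ j').trans ((hr j' _ (φ.2.1 j') l x).2 fun i _ => hl i)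
    have := habs l fun i => (hl i).trans (hu i)
    have := hopt j
    linarith
  -- If the observed agent is the truly worst one, its reward at `x` is already the true minimum and
  -- `l` is not needed.
  · by_cases hjj : j' = j
    · left
      have := habs x hu
      have := hopt j
      rw [hjj] at hj'
      linarith
    · right
      -- By the Lipschitz bound the reward of an empty bundle does not depend on the qualities, so
      -- the optimistic value would be the true one and leave no gap.
      have hne : (φ.1 j').Nonempty := by
        rw [Finset.nonempty_iff_ne_empty]
        intro he
        have h1 := (hr j' _ (φ.2.1 j') u x).1
        rw [he, Finset.sum_empty, mul_zero] at h1
        have h2 := (le_abs_self _).trans h1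
        have h3 := hopt j'
        rw [he] at h3 hj'
        linarith
      have hd := Finset.card_union_of_disjoint (φ.2.2 j j' (Ne.symm hjj))
      have hle := Finset.card_le_univ (φ.1 j ∪ φ.1 j')
      rw [Fintype.card_fin] at hle
      have := hne.card_pos
      omega

end Rewards

/-! ### Counts and confidence radii along a path. -/

section Record

variable {K N : ℕ} {A : Fin K → Set (Finset (Fin N))}
  (σ α : ℝ) (O₁ : (Fin N → ℝ) → Allocation A) (O₂ : (Fin N → ℝ) → Allocation A → Fin K)
  (X : ℕ → Fin N → ℝ)

lemma recordAfter_count_succ (t : ℕ) (i : Fin N) :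
    (recordAfter σ α O₁ O₂ X (t + 1)).count i = (recordAfter σ α O₁ O₂ X t).count i +
      if i ∈ chooseFeedback σ α O₁ O₂ (t + 1) (recordAfter σ α O₁ O₂ X t) then 1 else 0 := by
  simp only [recordAfter, Record.observe]
  split_ifs <;> rfl

lemma recordAfter_total_succ (t : ℕ) (i : Fin N) :
    (recordAfter σ α O₁ O₂ X (t + 1)).total i = (recordAfter σ α O₁ O₂ X t).total i +
      if i ∈ chooseFeedback σ α O₁ O₂ (t + 1) (recordAfter σ α O₁ O₂ X t)
        then X (t + 1) i else 0 := by
  simp only [recordAfter, Record.observe]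
  split_ifs <;> simp

lemma recordAfter_count_mono (i : Fin N) :
    Monotone fun t => (recordAfter σ α O₁ O₂ X t).count i :=
  monotone_nat_of_le_succ fun t => by rw [recordAfter_count_succ]; omega

lemma recordAfter_count_le (t : ℕ) (i : Fin N) : (recordAfter σ α O₁ O₂ X t).count i ≤ t := by
  induction t with
  | zero => simp [recordAfter]
  | succ t ih => rw [recordAfter_count_succ]; split_ifs <;> omega

lemma one_le_recordAfter_count {t : ℕ} (ht : N ≤ t) (i : Fin N) :
    1 ≤ (recordAfter σ α O₁ O₂ X t).count i := by
  refine le_trans ?_ (recordAfter_count_mono σ α O₁ O₂ X i (i.2.trans_le ht : i.val + 1 ≤ t))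
  have : i ∈ chooseFeedback σ α O₁ O₂ (i.val + 1) (recordAfter σ α O₁ O₂ X i.val) := by
    rw [chooseFeedback, if_pos (Nat.succ_le_of_lt i.2)]
    simp
  show 1 ≤ (recordAfter σ α O₁ O₂ X (i.val + 1)).count i
  rw [recordAfter_count_succ, if_pos this]
  omega

lemma recordAfter_count_lt {s t : ℕ} (hs : 1 ≤ s) (hst : s < t) {i : Fin N}
    (hi : i ∈ chooseFeedback σ α O₁ O₂ s (recordAfter σ α O₁ O₂ X (s - 1))) :
    (recordAfter σ α O₁ O₂ X (s - 1)).count i < (recordAfter σ α O₁ O₂ X (t - 1)).count i := by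
  obtain ⟨s, rfl⟩ := Nat.exists_eq_add_of_le' hs
  have h := recordAfter_count_succ σ α O₁ O₂ X s i
  rw [Nat.add_sub_cancel] at hi ⊢
  rw [if_pos hi] at h
  have := recordAfter_count_mono σ α O₁ O₂ X i (show s + 1 ≤ t - 1 by omega)
  dsimp only at this
  omega

/-- The count of a good is injective on the rounds in which it is observed. -/
lemma recordAfter_count_injOn {B : Finset ℕ} (hB : ∀ t ∈ B, 1 ≤ t) {i : Fin N}
    (hi : ∀ t ∈ B, i ∈ chooseFeedback σ α O₁ O₂ t (recordAfter σ α O₁ O₂ X (t - 1))) :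
    Set.InjOn (fun t => (recordAfter σ α O₁ O₂ X (t - 1)).count i) B := by
  intro s hs t ht h
  by_contra hne
  rcases lt_or_gt_of_ne hne with hlt | hlt
  · exact (recordAfter_count_lt σ α O₁ O₂ X (hB s hs) hlt (hi s hs)).ne h
  · exact (recordAfter_count_lt σ α O₁ O₂ X (hB t ht) hlt (hi t ht)).ne h.symm

/-- Adaptedness of the algorithm, in the form that later yields independence from the noise of the
next round. -/
lemma recordAfter_congr {X Y : ℕ → Fin N → ℝ} {t : ℕ} (h : ∀ s ≤ t, X s = Y s) :
    recordAfter σ α O₁ O₂ X t = recordAfter σ α O₁ O₂ Y t := by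
  induction t with
  | zero => rfl
  | succ t ih =>
    simp only [recordAfter]
    rw [ih fun s hs => h s (hs.trans t.le_succ), h (t + 1) le_rfl]

lemma Record.radius_eq (s : Record N) {σ : ℝ} (hσ : 0 < σ) (a : ℝ) {t : ℕ} (ht : 1 ≤ t)
    (i : Fin N) : s.radius σ a t i = σ * √(2 * a * Real.log t) / √(s.count i) := by
  rw [Record.radius, Real.log_rpow (by exact_mod_cast ht),
    show 1 / (s.count i : ℝ) * (2 * σ ^ 2 * (a * Real.log t)) =
      σ ^ 2 * (2 * a * Real.log t) / s.count i by ring, Real.sqrt_div' _ (Nat.cast_nonneg _),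
    Real.sqrt_mul (sq_nonneg σ), Real.sqrt_sq hσ.le]

/-- Removes the dependence on the round, so that only the count still varies; it also compares radii
with different exponents. -/
lemma Record.radius_le (s : Record N) {σ : ℝ} (hσ : 0 < σ) {a b : ℝ} (ha : 0 ≤ a) (hab : a ≤ b)
    {t T : ℕ} (ht : 1 ≤ t) (htT : t ≤ T) (i : Fin N) :
    s.radius σ a t i ≤ σ * √(2 * b * Real.log T) / √(s.count i) := by
  rw [s.radius_eq hσ a ht]
  have h1 : (1 : ℝ) ≤ t := by exact_mod_cast ht
  have h2 : Real.log t ≤ Real.log T := Real.log_le_log (by linarith) (by exact_mod_cast htT)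
  have h3 := Real.log_nonneg h1
  have h4 : 2 * a * Real.log t ≤ 2 * b * Real.log T :=
    mul_le_mul (by linarith) h2 h3 (by linarith)
  gcongr

end Record

/-! ### Counting rounds through the counts of goods, and a series bound. -/

section Counting

/-- Pigeonhole bound: if each round in `B` has a good `i` in its bundle whose count, injective in
the rounds that observe `i`, is positive and less than `L`, then `B` has at most `N * L` rounds. -/
lemma card_le_of_exists_count_lt {N : ℕ} (B : Finset ℕ) (F : ℕ → Finset (Fin N))
    (n : ℕ → Fin N → ℕ) (hpos : ∀ t ∈ B, ∀ i, 1 ≤ n t i)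
    (hinj : ∀ i, Set.InjOn (fun t => n t i) (B.filter fun t => i ∈ F t)) {L : ℝ} (hL : 0 ≤ L)
    (h : ∀ t ∈ B, ∃ i ∈ F t, (n t i : ℝ) ≤ L) : (B.card : ℝ) ≤ N * L := by
  have hsub : B ⊆ Finset.univ.biUnion fun i => B.filter fun t => i ∈ F t ∧ (n t i : ℝ) ≤ L := by
    intro t ht
    obtain ⟨i, hi, hiL⟩ := h t ht
    simp only [Finset.mem_biUnion, Finset.mem_univ, true_and, Finset.mem_filter]
    exact ⟨i, ht, hi, hiL⟩
  have hcard : ∀ i, (B.filter fun t => i ∈ F t ∧ (n t i : ℝ) ≤ L).card ≤ ⌊L⌋₊ := by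
    intro i
    rw [← Finset.card_image_of_injOn (f := fun t => n t i)]
    · refine (Finset.card_le_card (t := Finset.Icc 1 ⌊L⌋₊) ?_).trans_eq (by simp)
      intro m hm
      obtain ⟨t, ht, rfl⟩ := Finset.mem_image.1 hm
      rw [Finset.mem_filter] at ht
      exact Finset.mem_Icc.2 ⟨hpos t ht.1 i, Nat.le_floor ht.2.2⟩
    · refine (hinj i).mono fun t ht => ?_
      simp only [Finset.coe_filter, Set.mem_ofPred_eq] at ht ⊢
      exact ⟨ht.1, ht.2.1⟩
  have h1 : B.card ≤ N * ⌊L⌋₊ := by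
    refine (Finset.card_le_card hsub).trans (Finset.card_biUnion_le.trans ?_)
    simpa using Finset.sum_le_sum fun i (_ : i ∈ Finset.univ) => hcard i
  calc (B.card : ℝ) ≤ N * (⌊L⌋₊ : ℝ) := by exact_mod_cast h1
    _ ≤ N * L := by gcongr; exact Nat.floor_le hL

/-- The worst case is an initial segment: the largest of `k + 1` distinct positive integers is at
least `k + 1`, and `1 / √(k + 1) ≤ 2√(k + 1) - 2√k` telescopes. -/
lemma sum_inv_sqrt_le (J : Finset ℕ) (hJ : ∀ n ∈ J, 1 ≤ n) :
    ∑ n ∈ J, 1 / √(n : ℝ) ≤ 2 * √(J.card : ℝ) := by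
  induction J using Finset.induction_on_max with
  | empty => simp
  | insert m J hm ih =>
    have hmJ : m ∉ J := fun h => (hm m h).false
    rw [Finset.sum_insert hmJ, Finset.card_insert_of_notMem hmJ]
    have ih := ih fun n hn => hJ n (Finset.mem_insert_of_mem hn)
    have hle : J.card + 1 ≤ m := by
      have hsub : J ⊆ Finset.Icc 1 (m - 1) := fun n hn => by
        have := hm n hn
        exact Finset.mem_Icc.2 ⟨hJ n (Finset.mem_insert_of_mem hn), by omega⟩
      have := Finset.card_le_card hsub
      have := hJ m (Finset.mem_insert_self _ _)
      simp at *
      omega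
    have hc : ((J.card : ℝ) + 1) ≤ m := by exact_mod_cast hle
    push_cast
    have hk0 : (0 : ℝ) ≤ J.card := Nat.cast_nonneg _
    generalize (J.card : ℝ) = k at *
    have h1 : 1 / √(m : ℝ) ≤ 1 / √(k + 1) :=
      one_div_le_one_div_of_le (Real.sqrt_pos.2 (by linarith)) (Real.sqrt_le_sqrt hc)
    have h2 : 1 / √(k + 1) ≤ 2 * √(k + 1) - 2 * √k := by
      have hp : 0 < √(k + 1) := Real.sqrt_pos.2 (by linarith)
      rw [div_le_iff₀ hp]
      nlinarith [Real.sq_sqrt hk0, Real.sq_sqrt (show 0 ≤ k + 1 by linarith),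
        sq_nonneg (√(k + 1) - √k)]
    linarith

/-- If in each round in `B` the sum of `w / √n` over the bundle exceeds `D`, where `n` is the count
of a good, then `B` has at most `4 (N w / D)²` rounds. -/
lemma card_le_of_lt_sum {N : ℕ} (B : Finset ℕ) (F : ℕ → Finset (Fin N))
    (n : ℕ → Fin N → ℕ) (hpos : ∀ t ∈ B, ∀ i, 1 ≤ n t i)
    (hinj : ∀ i, Set.InjOn (fun t => n t i) (B.filter fun t => i ∈ F t)) {w D : ℝ} (hw : 0 ≤ w)
    (hD : 0 < D) (h : ∀ t ∈ B, D ≤ ∑ i ∈ F t, w / √(n t i : ℝ)) :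
    (B.card : ℝ) ≤ 4 * (N * w / D) ^ 2 := by
  rcases Nat.eq_zero_or_pos N with rfl | hN
  · have : B = ∅ := Finset.eq_empty_of_forall_notMem fun t ht => by
      have := h t ht
      rw [Finset.eq_empty_of_isEmpty (F t), Finset.sum_empty] at this
      linarith
    simp [this]
  have hN' : (0 : ℝ) < N := by exact_mod_cast hN
  -- Subtracting `b` from each of the at most `N` terms of a round costs at most `D / 2`, while it
  -- bounds the total contribution of each good uniformly in the number of rounds.
  set b := D / (2 * N) with hb
  have hb0 : 0 < b := by positivity
  have hgood : ∀ i, ∑ t ∈ B.filter (fun t => i ∈ F t), (w / √(n t i : ℝ) - b) ≤ w ^ 2 / b := by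
    intro i
    set J := (B.filter fun t => i ∈ F t).image fun t => n t i with hJ
    have h1 : ∑ t ∈ B.filter (fun t => i ∈ F t), (w / √(n t i : ℝ) - b) =
        ∑ m ∈ J, (w / √(m : ℝ) - b) := 
      (Finset.sum_image (f := fun m : ℕ => w / √(m : ℝ) - b) (hinj i)).symm
    rw [h1, Finset.sum_sub_distrib, Finset.sum_const, nsmul_eq_mul]
    have h2 : ∑ m ∈ J, w / √(m : ℝ) ≤ w * (2 * √(J.card : ℝ)) := by
      simp_rw [div_eq_mul_one_div w, ← Finset.mul_sum]
      refine mul_le_mul_of_nonneg_left (sum_inv_sqrt_le J fun m hm => ?_) hw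
      obtain ⟨t, ht, rfl⟩ := Finset.mem_image.1 hm
      exact hpos t (Finset.mem_filter.1 ht).1 i
    -- With `q = √J.card` this is `2wq - bq² ≤ w² / b`, a completed square.
    have h3 : w * (2 * √(J.card : ℝ)) - J.card * b ≤ w ^ 2 / b := by
      have h4 := Real.sq_sqrt (Nat.cast_nonneg (α := ℝ) J.card)
      generalize √(J.card : ℝ) = q at *
      rw [le_div_iff₀ hb0, ← h4]
      nlinarith [sq_nonneg (w - b * q)]
    linarith
  have hround : ∀ t ∈ B, D / 2 ≤ ∑ i ∈ F t, (w / √(n t i : ℝ) - b) := by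
    intro t ht
    rw [Finset.sum_sub_distrib, Finset.sum_const, nsmul_eq_mul]
    have h1 : ((F t).card : ℝ) ≤ N := by
      exact_mod_cast (Finset.card_le_univ (F t)).trans_eq (Fintype.card_fin N)
    have h2 : ((F t).card : ℝ) * b ≤ N * b := by gcongr
    have h3 : N * b = D / 2 := by rw [hb]; field_simp
    have := h t ht
    linarith
  have hsum : (B.card : ℝ) * (D / 2) ≤ N * (w ^ 2 / b) := by
    calc (B.card : ℝ) * (D / 2) = ∑ t ∈ B, D / 2 := by simp
      _ ≤ ∑ t ∈ B, ∑ i ∈ F t, (w / √(n t i : ℝ) - b) := Finset.sum_le_sum hround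
      _ = ∑ i, ∑ t ∈ B.filter (fun t => i ∈ F t), (w / √(n t i : ℝ) - b) :=
        Finset.sum_comm' (by simp [and_comm])
      _ ≤ ∑ _i : Fin N, w ^ 2 / b := Finset.sum_le_sum fun i _ => hgood i
      _ = N * (w ^ 2 / b) := by simp
  have h4 : N * (w ^ 2 / b) = 4 * (N * w / D) ^ 2 * (D / 2) := by
    rw [hb]; field_simp; ring
  rw [h4] at hsum
  exact le_of_mul_le_mul_right hsum (by positivity)

/-- Some term is at least the average. The factor `S.card` is kept, since a bundle of at most `N -
1` goods must give a better constant. -/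
lemma exists_lt_of_lt_mul_sum {ι : Type*} {S : Finset ι} {f : ι → ℝ} {c D : ℝ}
    (h : D < c * ∑ i ∈ S, f i) (hD : 0 < D) : ∃ i ∈ S, D < c * (S.card * f i) := by
  have hne : S.Nonempty := by
    rw [Finset.nonempty_iff_ne_empty]
    rintro rfl
    simp at h
    linarith
  have hc : (0 : ℝ) < S.card := by exact_mod_cast hne.card_pos
  by_contra! hcon
  have h1 : ∑ i ∈ S, c * (S.card * f i) ≤ ∑ _i ∈ S, D := Finset.sum_le_sum hcon
  rw [← Finset.mul_sum, ← Finset.mul_sum, Finset.sum_const, nsmul_eq_mul] at h1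
  nlinarith

/-- A discrete integral test: `(p - 2) * t ^ (1 - p)` is dominated by the decrement of `t ^ (2 -
p)`. The term `t = 1` is absent because `N ≥ 1`. -/
lemma sum_rpow_le {p : ℝ} (hp : 2 < p) {N : ℕ} (hN : 1 ≤ N) (T : ℕ) :
    ∑ t ∈ Finset.Ioc N T, (t : ℝ) ^ (1 - p) ≤ 1 / (p - 2) := by
  have hq : 0 < p - 2 := by linarith
  have hstep : ∀ t : ℕ, 1 ≤ t →
      (p - 2) * ((t + 1 : ℕ) : ℝ) ^ (1 - p) ≤ (t : ℝ) ^ (2 - p) - ((t + 1 : ℕ) : ℝ) ^ (2 - p) := by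
    intro t ht
    have ht0 : (0 : ℝ) < t := by exact_mod_cast ht
    push_cast
    obtain ⟨s, hs⟩ : ∃ s : ℝ, s = t := ⟨_, rfl⟩
    rw [← hs] at ht0 ⊢
    have hs1 : 0 < s + 1 := by linarith
    have h1 : (s + 1) ^ (1 - p) = (s + 1) ^ (2 - p) * (s + 1)⁻¹ := by
      rw [← Real.rpow_neg_one (s + 1), ← Real.rpow_add hs1]; ring_nf
    have h2 : s ^ (2 - p) = (s + 1) ^ (2 - p) * (s / (s + 1)) ^ (2 - p) := by
      rw [← Real.mul_rpow hs1.le (by positivity)]; congr 1; field_simp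
    -- A Bernoulli inequality with negative exponent, from the tangent line bounds `1 + y ≤ exp y`
    -- and `log y ≤ y - 1`.
    have h3 : 1 + (p - 2) * (s + 1)⁻¹ ≤ (s / (s + 1)) ^ (2 - p) := by
      rw [Real.rpow_def_of_pos (by positivity)]
      have h4 := Real.add_one_le_exp (Real.log (s / (s + 1)) * (2 - p))
      have h5 := Real.log_le_sub_one_of_pos (show 0 < s / (s + 1) by positivity)
      have h6 : s / (s + 1) - 1 = -(s + 1)⁻¹ := by field_simp; ring
      rw [h6] at h5
      nlinarith
    rw [h1, h2]
    have := Real.rpow_pos_of_pos hs1 (2 - p)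
    nlinarith
  have hind : ∀ M : ℕ, 1 ≤ M → (p - 2) * ∑ t ∈ Finset.Ioc 1 M, (t : ℝ) ^ (1 - p) ≤
      1 - (M : ℝ) ^ (2 - p) := by
    intro M hM
    induction M, hM using Nat.le_induction with
    | base => simp
    | succ M hM ih =>
      rw [← Finset.insert_Ioc_right_eq_Ioc_add_one hM, Finset.sum_insert (by simp), mul_add]
      have := hstep M hM
      linarith
  rcases Nat.eq_zero_or_pos T with rfl | hT
  · simp [hq.le]
  · have h1 := hind T hT
    have h2 : (0 : ℝ) ≤ (T : ℝ) ^ (2 - p) := by positivity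
    have h3 : ∑ t ∈ Finset.Ioc N T, (t : ℝ) ^ (1 - p) ≤ ∑ t ∈ Finset.Ioc 1 T, (t : ℝ) ^ (1 - p) :=
      Finset.sum_le_sum_of_subset_of_nonneg (Finset.Ioc_subset_Ioc_left hN)
        fun _ _ _ => by positivity
    rw [le_div_iff₀ hq]
    nlinarith

end Counting

lemma cast_le_sq_of_le_div_sqrt {n : ℕ} (hn : 1 ≤ n) {V D : ℝ} (hD : 0 < D)
    (h : D ≤ V / √(n : ℝ)) : (n : ℝ) ≤ (V / D) ^ 2 := by
  have hp : 0 < √(n : ℝ) := Real.sqrt_pos.2 (by exact_mod_cast hn)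
  rw [le_div_iff₀ hp] at h
  rw [← Real.sq_sqrt (Nat.cast_nonneg (α := ℝ) n)]
  refine pow_le_pow_left₀ hp.le ?_ 2
  rw [le_div_iff₀ hD]
  linarith

/-! ### Suboptimal rounds in which the confidence bounds hold. -/

section Deterministic

variable {K N : ℕ} {A : Fin K → Set (Finset (Fin N))}
  {r : Fin K → (Fin N → ℝ) → Finset (Fin N) → ℝ}

/-- As long as the confidence bounds hold, suboptimal allocations are chosen `O(log T)` times. -/
lemma card_suboptimal_le (hK : 1 ≤ K) (hA : ∀ j, ∅ ∈ A j) {μ : Fin N → ℝ} {α p σ c Δmin : ℝ}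
    (hp : 0 ≤ p) (hpα : p ≤ α) (hp4 : p ≤ 4) (hσ : 0 < σ) (hc : 0 < c) (hΔ : 0 < Δmin)
    (hr : LipschitzMonotone A r c) (hmin : MinGap A r μ Δmin)
    {O₁ : (Fin N → ℝ) → Allocation A} (hO₁ : IsMaxMinOracle r O₁)
    {O₂ : (Fin N → ℝ) → Allocation A → Fin K} (hO₂ : IsMinAgentOracle r O₂)
    (X : ℕ → Fin N → ℝ) {T : ℕ} {B : Finset ℕ} (hB : B ⊆ Finset.Ioc N T)
    (hu : ∀ t ∈ B, ∀ i, μ i ≤ (recordAfter σ α O₁ O₂ X (t - 1)).ucb σ α t i)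
    (hm : ∀ t ∈ B, ∀ i, (recordAfter σ α O₁ O₂ X (t - 1)).mean i ≤
      μ i + (recordAfter σ α O₁ O₂ X (t - 1)).radius σ p t i)
    (hbad : ∀ t ∈ B, O₁ ((recordAfter σ α O₁ O₂ X (t - 1)).ucb σ α t) ∉ optimalAllocations A r μ) :
    (B.card : ℝ) ≤ 3 * N * ((√(2 * α) + 2) ^ 2 * c ^ 2 * (N : ℝ) ^ 2 * σ ^ 2 / Δmin ^ 2 *
      Real.log T) := by
  have hα : 0 ≤ α := hp.trans hpα
  set F : ℕ → Finset (Fin N) := fun t =>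
    chooseFeedback σ α O₁ O₂ t (recordAfter σ α O₁ O₂ X (t - 1)) with hF
  set n : ℕ → Fin N → ℕ := fun t i => (recordAfter σ α O₁ O₂ X (t - 1)).count i with hn
  have hBN : ∀ t ∈ B, N < t ∧ t ≤ T := fun t ht => Finset.mem_Ioc.1 (hB ht)
  have hpos : ∀ t ∈ B, ∀ i, 1 ≤ n t i := fun t ht i => by
    have := hBN t ht
    exact one_le_recordAfter_count σ α O₁ O₂ X (by omega) i
  have hinj : ∀ i, Set.InjOn (fun t => n t i) (B.filter fun t => i ∈ F t) := fun i =>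
    recordAfter_count_injOn σ α O₁ O₂ X
      (fun t ht => by have := hBN t (Finset.mem_filter.1 ht).1; omega)
      (fun t ht => (Finset.mem_filter.1 ht).2)
  obtain ⟨l, hl⟩ : ∃ l, l = √(Real.log T) := ⟨_, rfl⟩
  have hlog : 0 ≤ Real.log T := Real.log_natCast_nonneg T
  have hl2 : l ^ 2 = Real.log T := by rw [hl]; exact Real.sq_sqrt hlog
  have hl0 : 0 ≤ l := hl ▸ Real.sqrt_nonneg _
  obtain ⟨a, ha⟩ : ∃ a, a = √(2 * α) := ⟨_, rfl⟩
  have ha0 : 0 ≤ a := ha ▸ Real.sqrt_nonneg _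
  have hsα : √(2 * α * Real.log T) = a * l := by
    rw [Real.sqrt_mul (by linarith), ha, hl]
  -- Capping `p` at `4` is what produces the summand `2` in `√(2 * α) + 2`.
  have hs4 : √(2 * 4 * Real.log T) = √2 * 2 * l := by
    rw [Real.sqrt_mul (by norm_num), hl, Real.sqrt_mul (by norm_num),
      show (4 : ℝ) = 2 ^ 2 by norm_num, Real.sqrt_sq (by norm_num)]
  have hrα : ∀ t ∈ B, ∀ i, (recordAfter σ α O₁ O₂ X (t - 1)).radius σ α t i ≤
      σ * (a * l) / √(n t i : ℝ) := fun t ht i => by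
    have := hBN t ht
    rw [← hsα]
    exact Record.radius_le _ hσ hα le_rfl (by omega) this.2 i
  have hrp : ∀ t ∈ B, ∀ i, (recordAfter σ α O₁ O₂ X (t - 1)).radius σ p t i ≤
      σ * (√2 * 2 * l) / √(n t i : ℝ) := fun t ht i => by
    have := hBN t ht
    rw [← hs4]
    exact Record.radius_le _ hσ hp hp4 (by omega) this.2 i
  have hpα' : ∀ t ∈ B, ∀ i, (recordAfter σ α O₁ O₂ X (t - 1)).radius σ p t i ≤
      (recordAfter σ α O₁ O₂ X (t - 1)).radius σ α t i := fun t ht i => by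
    have := hBN t ht
    refine (Record.radius_le _ hσ hp hpα (by omega) (le_refl t) i).trans_eq ?_
    rw [Record.radius_eq _ hσ _ (by omega)]
  have hround : ∀ t ∈ B, Δmin < c * ∑ i ∈ F t, 2 * σ * (a * l) / √(n t i : ℝ) ∧
      (Δmin < c * ∑ i ∈ F t, √2 * σ * ((a + 2) * l) / √(n t i : ℝ) ∨ (F t).card + 1 ≤ N) := by
    intro t ht
    have hFt : F t = (O₁ ((recordAfter σ α O₁ O₂ X (t - 1)).ucb σ α t)).1
        (O₂ ((recordAfter σ α O₁ O₂ X (t - 1)).lcb σ α t)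
          (O₁ ((recordAfter σ α O₁ O₂ X (t - 1)).ucb σ α t))) := by
      simp only [hF, chooseFeedback]
      rw [if_neg (not_le.2 (hBN t ht).1)]
    have hlc : ∀ i, (recordAfter σ α O₁ O₂ X (t - 1)).lcb σ α t i ≤ μ i := fun i => by
      have h1 := hm t ht i
      have h2 := hpα' t ht i
      simp only [Record.lcb]
      linarith
    have key := gap_lt_of_suboptimal hK hA hΔ hr hmin hO₁ hO₂ (hu t ht) hlc (hbad t ht)
    rw [← hFt] at key
    have hsq2 : 1 ≤ √(2 : ℝ) := Real.one_le_sqrt.2 (by norm_num)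
    refine ⟨key.1.trans_le ?_, key.2.imp (fun h => h.trans_le ?_) id⟩
    · refine mul_le_mul_of_nonneg_left (Finset.sum_le_sum fun i _ => ?_) hc.le
      have h1 := hrα t ht i
      simp only [Record.ucb, Record.lcb]
      calc _ ≤ 2 * (σ * (a * l) / √(n t i : ℝ)) := by linarith
        _ = _ := by ring
    · refine mul_le_mul_of_nonneg_left (Finset.sum_le_sum fun i _ => ?_) hc.le
      have h1 := hrα t ht i
      have h2 := hrp t ht i
      have h3 := hm t ht i
      -- Pads `a + 2√2` to `√2 * (a + 2)`; the factor `√2` becomes `2 ≤ 3` after squaring.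
      have h4 : 0 ≤ (√2 - 1) * (σ * (a * l) / √(n t i : ℝ)) :=
        mul_nonneg (by linarith) (by positivity)
      simp only [Record.ucb]
      calc _ ≤ σ * (√2 * 2 * l) / √(n t i : ℝ) + σ * (a * l) / √(n t i : ℝ) +
            (√2 - 1) * (σ * (a * l) / √(n t i : ℝ)) := by linarith
        _ = _ := by ring
  rw [← ha, ← hl2]
  have hN0 : (0 : ℝ) ≤ N := Nat.cast_nonneg N
  -- The pigeonhole count needs `4 (N - 1)² ≤ 3 N²`, true for `1 ≤ N ≤ 6`; the summation count needs
  -- `16 ≤ 3 N`, true for `N ≥ 6`.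
  rcases le_or_gt N 6 with hN | hN
  · have hV : ∀ t ∈ B, ∃ i ∈ F t, (n t i : ℝ) ≤
        3 * ((a + 2) ^ 2 * c ^ 2 * (N : ℝ) ^ 2 * σ ^ 2 / Δmin ^ 2 * l ^ 2) := by
      intro t ht
      have h := hround t ht
      have hcard : ((F t).card : ℝ) ≤ N := by
        exact_mod_cast (Finset.card_le_univ (F t)).trans_eq (Fintype.card_fin N)
      rcases h.2 with h1 | h1
      · obtain ⟨i, hi, h2⟩ := exists_lt_of_lt_mul_sum h1 hΔ
        refine ⟨i, hi, ?_⟩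
        have h3 : Δmin ≤ (c * (N * (√2 * σ * ((a + 2) * l)))) / √(n t i : ℝ) := by
          calc Δmin ≤ c * (N * (√2 * σ * ((a + 2) * l) / √(n t i : ℝ))) := h2.le.trans (by gcongr)
            _ = _ := by ring
        refine (cast_le_sq_of_le_div_sqrt (hpos t ht i) hΔ h3).trans ?_
        have h4 : (c * (N * (√2 * σ * ((a + 2) * l))) / Δmin) ^ 2 = √2 ^ 2 *
            ((a + 2) ^ 2 * c ^ 2 * (N : ℝ) ^ 2 * σ ^ 2 / Δmin ^ 2 * l ^ 2) := by
          field_simp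
        rw [h4, Real.sq_sqrt (by norm_num)]
        gcongr
        norm_num
      · obtain ⟨i, hi, h2⟩ := exists_lt_of_lt_mul_sum h.1 hΔ
        refine ⟨i, hi, ?_⟩
        have hcard' : ((F t).card : ℝ) ≤ N - 1 := by
          have : (((F t).card + 1 : ℕ) : ℝ) ≤ N := by exact_mod_cast h1
          push_cast at this
          linarith
        have h3 : Δmin ≤ (c * ((N - 1) * (2 * σ * (a * l)))) / √(n t i : ℝ) := by
          calc Δmin ≤ c * ((N - 1) * (2 * σ * (a * l) / √(n t i : ℝ))) := h2.le.trans (by gcongr)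
            _ = _ := by ring
        refine (cast_le_sq_of_le_div_sqrt (hpos t ht i) hΔ h3).trans ?_
        have h4 : (c * ((N - 1) * (2 * σ * (a * l))) / Δmin) ^ 2 =
            4 * (N - 1 : ℝ) ^ 2 * (a ^ 2 * (c ^ 2 * σ ^ 2 / Δmin ^ 2 * l ^ 2)) := by
          field_simp
          ring
        have h5 : 4 * (N - 1 : ℝ) ^ 2 ≤ 3 * (N : ℝ) ^ 2 := by
          have h6 : (N : ℝ) ≤ 6 := by exact_mod_cast hN
          have h7 : (1 : ℝ) ≤ N := by exact_mod_cast (Nat.le_add_left 1 _).trans h1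
          nlinarith
        calc _ = 4 * (N - 1 : ℝ) ^ 2 * (a ^ 2 * (c ^ 2 * σ ^ 2 / Δmin ^ 2 * l ^ 2)) := h4
          _ ≤ 3 * (N : ℝ) ^ 2 * ((a + 2) ^ 2 * (c ^ 2 * σ ^ 2 / Δmin ^ 2 * l ^ 2)) := by
            gcongr
            linarith
          _ = _ := by ring
    refine (card_le_of_exists_count_lt B F n hpos hinj (by positivity) hV).trans_eq ?_
    ring
  · have hV : ∀ t ∈ B, Δmin ≤ ∑ i ∈ F t, (c * (2 * σ * (a * l))) / √(n t i : ℝ) := by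
      intro t ht
      refine (hround t ht).1.le.trans_eq ?_
      rw [Finset.mul_sum]
      exact Finset.sum_congr rfl fun i _ => by ring
    refine (card_le_of_lt_sum B F n hpos hinj (by positivity) hΔ hV).trans ?_
    have h6 : (6 : ℝ) ≤ N := by exact_mod_cast hN.le
    calc _ = 16 * (N : ℝ) ^ 2 * (a ^ 2 * (c ^ 2 * σ ^ 2 / Δmin ^ 2 * l ^ 2)) := by
          field_simp
          ring
      _ ≤ 3 * (N : ℝ) * (N : ℝ) ^ 2 * ((a + 2) ^ 2 * (c ^ 2 * σ ^ 2 / Δmin ^ 2 * l ^ 2)) := by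
          gcongr <;> linarith
      _ = _ := by ring

end Deterministic

/-! ### Measurability of the algorithm's choices. -/

section Measurability

variable {K N : ℕ} {A : Fin K → Set (Finset (Fin N))} {σ α : ℝ}
  {O₁ : (Fin N → ℝ) → Allocation A} {O₂ : (Fin N → ℝ) → Allocation A → Fin K}
  {γ : Type*} [MeasurableSpace γ] {s : γ → Record N}

lemma measurable_mean (hs : ∀ i, Measurable fun g => (s g).count i)
    (hs' : ∀ i, Measurable fun g => (s g).total i) (i : Fin N) :
    Measurable fun g => (s g).mean i :=
  (hs' i).div (measurable_from_top.comp (hs i))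

lemma measurable_radius (hs : ∀ i, Measurable fun g => (s g).count i) (a : ℝ) (t : ℕ)
    (i : Fin N) : Measurable fun g => (s g).radius σ a t i :=
  (measurable_from_top (f := fun n : ℕ =>
    √(1 / (n : ℝ) * (2 * σ ^ 2 * Real.log ((t : ℝ) ^ a))))).comp (hs i)

lemma measurable_ucb (hs : ∀ i, Measurable fun g => (s g).count i)
    (hs' : ∀ i, Measurable fun g => (s g).total i) (t : ℕ) :
    Measurable fun g => (s g).ucb σ α t :=
  measurable_pi_lambda _ fun i => (measurable_mean hs hs' i).add (measurable_radius hs α t i)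

lemma measurable_lcb (hs : ∀ i, Measurable fun g => (s g).count i)
    (hs' : ∀ i, Measurable fun g => (s g).total i) (t : ℕ) :
    Measurable fun g => (s g).lcb σ α t :=
  measurable_pi_lambda _ fun i => (measurable_mean hs hs' i).sub (measurable_radius hs α t i)

lemma measurableSet_mem_chooseFeedback (hO₁ : Measurable O₁)
    (hO₂ : ∀ φ, Measurable fun x => O₂ x φ) (hs : ∀ i, Measurable fun g => (s g).count i)
    (hs' : ∀ i, Measurable fun g => (s g).total i) (t : ℕ) (i : Fin N) :
    MeasurableSet {g | i ∈ chooseFeedback σ α O₁ O₂ t (s g)} := by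
  simp only [chooseFeedback]
  split_ifs
  · exact MeasurableSet.const _
  · have h1 : Measurable fun g => O₁ ((s g).ucb σ α t) := hO₁.comp (measurable_ucb hs hs' t)
    have h2 : ∀ φ, Measurable fun g => O₂ ((s g).lcb σ α t) φ := fun φ =>
      (hO₂ φ).comp (measurable_lcb hs hs' t)
    -- The second oracle is measurable only for a fixed allocation, so the event is split over the
    -- finitely many allocations.
    have h3 : {g | i ∈ (O₁ ((s g).ucb σ α t)).1
          (O₂ ((s g).lcb σ α t) (O₁ ((s g).ucb σ α t)))} =
        ⋃ φ : Allocation A, ((fun g => O₁ ((s g).ucb σ α t)) ⁻¹' {φ}) ∩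
          ((fun g => O₂ ((s g).lcb σ α t) φ) ⁻¹' {j | i ∈ φ.1 j}) := by
      ext g
      simp
    rw [h3]
    exact MeasurableSet.iUnion fun φ => (h1 (MeasurableSet.of_discrete)).inter
      (h2 φ (MeasurableSet.of_discrete))

lemma measurable_recordAfter (hO₁ : Measurable O₁) (hO₂ : ∀ φ, Measurable fun x => O₂ x φ)
    (t : ℕ) : (∀ i, Measurable fun X => (recordAfter σ α O₁ O₂ X t).count i) ∧
      ∀ i, Measurable fun X => (recordAfter σ α O₁ O₂ X t).total i := by
  induction t with
  | zero => exact ⟨fun i => measurable_const, fun i => measurable_const⟩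
  | succ t ih =>
    have hset := measurableSet_mem_chooseFeedback (σ := σ) (α := α) hO₁ hO₂ ih.1 ih.2 (t + 1)
    refine ⟨fun i => ?_, fun i => ?_⟩
    · simp_rw [recordAfter_count_succ]
      exact (ih.1 i).add (Measurable.ite (hset i) measurable_const measurable_const)
    · simp_rw [recordAfter_total_succ]
      refine (ih.2 i).add (Measurable.ite (hset i) ?_ measurable_const)
      exact (measurable_pi_apply i).comp (measurable_pi_apply (t + 1))

lemma measurable_duelingAllocation (hO₁ : Measurable O₁) (hO₂ : ∀ φ, Measurable fun x => O₂ x φ)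
    (start : ℕ → Allocation A) (t : ℕ) :
    Measurable fun X => duelingAllocation σ α O₁ O₂ start X t := by
  have h := measurable_recordAfter (σ := σ) (α := α) hO₁ hO₂ (t - 1)
  simp only [duelingAllocation, chooseAllocation]
  split_ifs
  · exact measurable_const
  · exact hO₁.comp (measurable_ucb h.1 h.2 t)

end Measurability

/-! ### Concentration under adaptive sampling. -/

section Concentration

variable {K N : ℕ} {A : Fin K → Set (Finset (Fin N))} {σ α : ℝ}
  {O₁ : (Fin N → ℝ) → Allocation A} {O₂ : (Fin N → ℝ) → Allocation A → Fin K}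
  {Ω : Type*} [MeasurableSpace Ω] {P : Measure Ω} {ε : ℕ → Fin N → Ω → ℝ} {μ : Fin N → ℝ}

/-- A function of the signals up to round `t` is independent of the noise in round `t + 1`. -/
lemma indepFun_of_forall_le (hεm : ∀ t i, Measurable (ε t i))
    (hεind : iIndepFun (fun t ω i => ε t i ω) P) {β : Type*} [MeasurableSpace β] (t : ℕ)
    {f : (ℕ → Fin N → ℝ) → β} (hf : Measurable f)
    (hdep : ∀ X Y : ℕ → Fin N → ℝ, (∀ s ≤ t, X s = Y s) → f X = f Y) (i : Fin N) :
    IndepFun (fun ω => f fun s j => μ j + ε s j ω) (ε (t + 1) i) P := by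
  have h := hεind.indepFun_finset (Finset.range (t + 1)) {t + 1} (by simp)
    fun s => measurable_pi_lambda _ fun j => hεm s j
  -- Rebuilds a signal path from the noise up to round `t`, with zero noise afterwards; `f` does not
  -- see the difference.
  let e : (Finset.range (t + 1) → Fin N → ℝ) → ℕ → Fin N → ℝ := fun y s j =>
    μ j + if hs : s ∈ Finset.range (t + 1) then y ⟨s, hs⟩ j else 0
  have he : Measurable e := by
    refine measurable_pi_lambda _ fun s => measurable_pi_lambda _ fun j => ?_
    refine measurable_const.add ?_
    by_cases hs : s ∈ Finset.range (t + 1)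
    · simp only [dif_pos hs]
      exact (measurable_pi_apply j).comp (measurable_pi_apply _)
    · simp only [dif_neg hs]
      exact measurable_const
  have hlast : Measurable fun y : ({t + 1} : Finset ℕ) → Fin N → ℝ =>
      y ⟨t + 1, Finset.mem_singleton_self _⟩ i := by
    fun_prop
  have h2 := h.comp (hf.comp he) hlast
  have heq : (fun ω => f fun s j => μ j + ε s j ω) =
      (f ∘ e) ∘ fun ω (s : Finset.range (t + 1)) j => ε s j ω := by
    funext ω
    refine hdep _ _ fun s hs => ?_
    have hmem : s ∈ Finset.range (t + 1) := Finset.mem_range.2 (by omega)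
    ext j
    simp only [e, dif_pos hmem]
  rw [heq]
  exact h2

lemma lintegral_exp_le_one [IsProbabilityMeasure P]
    (hεsub : ∀ t i, HasSubgaussianMGF (ε t i) (Real.toNNReal (σ ^ 2)) P) (b : ℝ) (t : ℕ)
    (i : Fin N) :
    ∫⁻ ω, ENNReal.ofReal (Real.exp (b * ε t i ω - b ^ 2 * σ ^ 2 / 2)) ∂P ≤ 1 := by
  have hint : Integrable (fun ω => Real.exp (b * ε t i ω - b ^ 2 * σ ^ 2 / 2)) P := by
    simp_rw [Real.exp_sub]
    exact ((hεsub t i).integrable_exp_mul b).div_const _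
  rw [← ofReal_integral_eq_lintegral_ofReal hint (ae_of_all _ fun ω => (Real.exp_pos _).le)]
  refine ENNReal.ofReal_le_one.2 ?_
  simp_rw [Real.exp_sub]
  rw [integral_div, div_le_one (Real.exp_pos _)]
  refine ((hεsub t i).mgf_le b).trans_eq ?_
  rw [Real.coe_toNNReal _ (sq_nonneg σ), mul_comm (σ ^ 2)]

/-- The exponential supermartingale of the noise accumulated on good `i`. -/
lemma lintegral_exp_noise_le_one [IsProbabilityMeasure P] (hεm : ∀ t i, Measurable (ε t i))
    (hεsub : ∀ t i, HasSubgaussianMGF (ε t i) (Real.toNNReal (σ ^ 2)) P)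
    (hεind : iIndepFun (fun t ω i => ε t i ω) P) (hO₁ : Measurable O₁)
    (hO₂ : ∀ φ, Measurable fun x => O₂ x φ) (b : ℝ) (t : ℕ) (i : Fin N) :
    ∫⁻ ω, ENNReal.ofReal (Real.exp
      (b * ((recordAfter σ α O₁ O₂ (fun s j => μ j + ε s j ω) t).total i -
        (recordAfter σ α O₁ O₂ (fun s j => μ j + ε s j ω) t).count i * μ i) -
        b ^ 2 * σ ^ 2 / 2 * (recordAfter σ α O₁ O₂ (fun s j => μ j + ε s j ω) t).count i)) ∂P
      ≤ 1 := by
  induction t with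
  | zero => simp [recordAfter]
  | succ t ih =>
    have hrec := measurable_recordAfter (σ := σ) (α := α) hO₁ hO₂ t
    have hset := measurableSet_mem_chooseFeedback (σ := σ) (α := α) hO₁ hO₂ hrec.1 hrec.2
      (t + 1) i
    set E : Set (ℕ → Fin N → ℝ) :=
      {X | i ∈ chooseFeedback σ α O₁ O₂ (t + 1) (recordAfter σ α O₁ O₂ X t)} with hE
    set M : (ℕ → Fin N → ℝ) → ENNReal := fun X => ENNReal.ofReal (Real.exp
      (b * ((recordAfter σ α O₁ O₂ X t).total i - (recordAfter σ α O₁ O₂ X t).count i * μ i) -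
        b ^ 2 * σ ^ 2 / 2 * (recordAfter σ α O₁ O₂ X t).count i)) with hM
    have hMm : Measurable M := by
      have h1 : Measurable fun X => ((recordAfter σ α O₁ O₂ X t).count i : ℝ) :=
        measurable_from_top.comp (hrec.1 i)
      have h2 := hrec.2 i
      exact ENNReal.measurable_ofReal.comp (Real.measurable_exp.comp
        (((h2.sub (h1.mul_const _)).const_mul _).sub (h1.const_mul _)))
    set x : Ω → ℕ → Fin N → ℝ := fun ω s j => μ j + ε s j ω with hx
    have hxm : Measurable x := measurable_pi_lambda _ fun s => measurable_pi_lambda _ fun j =>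
      (hεm s j).const_add _
    set g : ℝ → ENNReal := fun y => ENNReal.ofReal (Real.exp (b * y - b ^ 2 * σ ^ 2 / 2)) with hg
    have hgm : Measurable g := by fun_prop
    -- The process is unchanged off `E` and gains the factor `g` on `E`. Whether `E` occurs is
    -- decided before round `t + 1`, so this factor is independent of the rest and has mean at most
    -- `1`.
    have hsplit : ∀ ω, ENNReal.ofReal (Real.exp
        (b * ((recordAfter σ α O₁ O₂ (x ω) (t + 1)).total i -
          (recordAfter σ α O₁ O₂ (x ω) (t + 1)).count i * μ i) -
          b ^ 2 * σ ^ 2 / 2 * (recordAfter σ α O₁ O₂ (x ω) (t + 1)).count i)) =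
        Eᶜ.indicator M (x ω) + E.indicator M (x ω) * g (ε (t + 1) i ω) := by
      intro ω
      rw [recordAfter_count_succ, recordAfter_total_succ]
      by_cases h : x ω ∈ E
      · have h' : i ∈ chooseFeedback σ α O₁ O₂ (t + 1) (recordAfter σ α O₁ O₂ (x ω) t) := h
        rw [Set.indicator_of_mem h, Set.indicator_of_notMem (by simpa using h), zero_add,
          if_pos h', if_pos h', hM, hg]
        dsimp only
        rw [← ENNReal.ofReal_mul (Real.exp_pos _).le, ← Real.exp_add]
        congr 2
        simp only [hx]
        push_cast
        ring
      · have h' : i ∉ chooseFeedback σ α O₁ O₂ (t + 1) (recordAfter σ α O₁ O₂ (x ω) t) := h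
        rw [Set.indicator_of_notMem h, Set.indicator_of_mem (by simpa using h), zero_mul,
          if_neg h', if_neg h', hM]
        simp
    have hdepE : ∀ X Y : ℕ → Fin N → ℝ, (∀ s ≤ t, X s = Y s) →
        E.indicator M X = E.indicator M Y := fun X Y h => by
      simp only [Set.indicator, hE, hM, Set.mem_ofPred_eq, recordAfter_congr σ α O₁ O₂ h]
    have hind := (indepFun_of_forall_le (μ := μ) hεm hεind t (hMm.indicator hset) hdepE i).comp
      measurable_id hgm
    have hmul : ∫⁻ ω, E.indicator M (x ω) * g (ε (t + 1) i ω) ∂P ≤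
        ∫⁻ ω, E.indicator M (x ω) ∂P := by
      rw [lintegral_mul_eq_lintegral_mul_lintegral_of_indepFun''
        (f := fun ω => E.indicator M (x ω)) (g := fun ω => g (ε (t + 1) i ω))
        ((hMm.indicator hset).comp hxm).aemeasurable (hgm.comp (hεm _ i)).aemeasurable hind]
      exact mul_le_of_le_one_right' (lintegral_exp_le_one hεsub b (t + 1) i)
    calc _ = ∫⁻ ω, (Eᶜ.indicator M (x ω) + E.indicator M (x ω) * g (ε (t + 1) i ω)) ∂P :=
          lintegral_congr hsplit
      _ = ∫⁻ ω, Eᶜ.indicator M (x ω) ∂P + ∫⁻ ω, E.indicator M (x ω) * g (ε (t + 1) i ω) ∂P :=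
          lintegral_add_left ((hMm.indicator hset.compl).comp hxm) _
      _ ≤ ∫⁻ ω, Eᶜ.indicator M (x ω) ∂P + ∫⁻ ω, E.indicator M (x ω) ∂P := by gcongr
      _ = ∫⁻ ω, (Eᶜ.indicator M (x ω) + E.indicator M (x ω)) ∂P :=
          (lintegral_add_left ((hMm.indicator hset.compl).comp hxm) _).symm
      _ = ∫⁻ ω, M (x ω) ∂P := lintegral_congr fun ω => by
          rw [← Pi.add_apply, Set.indicator_compl_add_self]
      _ ≤ 1 := ih

/-- Deviation inequality for the noise accumulated on good `i` before round `t`, where the sign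
`η = ±1` gives the direction. -/
lemma measureReal_noise_le [IsProbabilityMeasure P] (hσ : 0 < σ) (hεm : ∀ t i, Measurable (ε t i))
    (hεsub : ∀ t i, HasSubgaussianMGF (ε t i) (Real.toNNReal (σ ^ 2)) P)
    (hεind : iIndepFun (fun t ω i => ε t i ω) P) (hO₁ : Measurable O₁)
    (hO₂ : ∀ φ, Measurable fun x => O₂ x φ) {η : ℝ} (hη : η ^ 2 = 1) {p : ℝ} (hp : 0 ≤ p)
    {t : ℕ} (ht : 1 ≤ t) (i : Fin N) :
    P.real {ω | 1 ≤ (recordAfter σ α O₁ O₂ (fun s j => μ j + ε s j ω) (t - 1)).count i ∧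
      (recordAfter σ α O₁ O₂ (fun s j => μ j + ε s j ω) (t - 1)).radius σ p t i <
        η * ((recordAfter σ α O₁ O₂ (fun s j => μ j + ε s j ω) (t - 1)).mean i - μ i)} ≤
      (t : ℝ) ^ (1 - p) := by
  set x : Ω → ℕ → Fin N → ℝ := fun ω s j => μ j + ε s j ω with hx
  have ht0 : (0 : ℝ) < t := by exact_mod_cast ht
  have hlog : 0 ≤ Real.log t := Real.log_natCast_nonneg t
  set a := √(2 * p * Real.log t) with ha
  have ha2 : a ^ 2 = 2 * p * Real.log t := Real.sq_sqrt (by positivity)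
  set R : ℕ → Set Ω := fun n => {ω | (recordAfter σ α O₁ O₂ (x ω) (t - 1)).count i = n ∧
    (recordAfter σ α O₁ O₂ (x ω) (t - 1)).radius σ p t i <
      η * ((recordAfter σ α O₁ O₂ (x ω) (t - 1)).mean i - μ i)} with hR
  -- The count is random and depends on the noise. Fixing its value `n` permits a Chernoff parameter
  -- tuned to `n`; the union over `n ≤ t - 1` then costs a factor at most `t`.
  have hRle : ∀ n, 1 ≤ n → P.real (R n) ≤ (t : ℝ) ^ (-p) := by
    intro n hn
    have hn0 : (0 : ℝ) < n := by exact_mod_cast hn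
    have hq : 0 < √(n : ℝ) := Real.sqrt_pos.2 hn0
    have hq2 : √(n : ℝ) ^ 2 = n := Real.sq_sqrt hn0.le
    -- The optimal Chernoff parameter: on `R n` the linear term is at least `a²` and the compensator
    -- is `a² / 2`, leaving `a² / 2 = p * log t`.
    set b := η * (a / (σ * √(n : ℝ))) with hb
    have hsup := lintegral_exp_noise_le_one (α := α) (μ := μ) hεm hεsub hεind hO₁ hO₂ b (t - 1) i
    have hpos : 0 < (t : ℝ) ^ p := Real.rpow_pos_of_pos ht0 p
    have hrec := measurable_recordAfter (σ := σ) (α := α) hO₁ hO₂ (t - 1)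
    have hxm : Measurable x := measurable_pi_lambda _ fun s => measurable_pi_lambda _ fun j =>
      (hεm s j).const_add _
    have h1 : Measurable fun ω => ((recordAfter σ α O₁ O₂ (x ω) (t - 1)).count i : ℝ) :=
      measurable_from_top.comp ((hrec.1 i).comp hxm)
    have h2 : Measurable fun ω => (recordAfter σ α O₁ O₂ (x ω) (t - 1)).total i :=
      (hrec.2 i).comp hxm
    have hmark := meas_ge_le_lintegral_div (μ := P) (ENNReal.measurable_ofReal.comp
      (Real.measurable_exp.comp (((h2.sub (h1.mul_const (μ i))).const_mul b).sub
        (h1.const_mul (b ^ 2 * σ ^ 2 / 2))))).aemeasurable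
      (ENNReal.ofReal_pos.2 hpos).ne' ENNReal.ofReal_ne_top
    have hsub : R n ⊆ {ω | ENNReal.ofReal ((t : ℝ) ^ p) ≤ ENNReal.ofReal (Real.exp
        (b * ((recordAfter σ α O₁ O₂ (x ω) (t - 1)).total i -
          (recordAfter σ α O₁ O₂ (x ω) (t - 1)).count i * μ i) -
          b ^ 2 * σ ^ 2 / 2 * (recordAfter σ α O₁ O₂ (x ω) (t - 1)).count i))} := by
      rintro ω ⟨hcount, hlt⟩
      refine ENNReal.ofReal_le_ofReal ?_
      rw [Record.radius_eq _ hσ p ht, Record.mean, hcount, ← ha] at hlt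
      rw [hcount, Real.rpow_def_of_pos ht0]
      refine Real.exp_le_exp.2 ?_
      set G := (recordAfter σ α O₁ O₂ (x ω) (t - 1)).total i
      have h3 : σ * a * √(n : ℝ) ≤ η * (G - n * μ i) := by
        have h4 : σ * a / √(n : ℝ) * n = σ * a * √(n : ℝ) := by
          nth_rewrite 2 [← hq2]; field_simp
        have h5 : η * (G / n - μ i) * n = η * (G - n * μ i) := by field_simp
        rw [← h4, ← h5]
        exact mul_le_mul_of_nonneg_right hlt.le hn0.le
      have h6 : b * (G - n * μ i) = a / (σ * √(n : ℝ)) * (η * (G - n * μ i)) := by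
        rw [hb]; ring
      have h7 : a / (σ * √(n : ℝ)) * (σ * a * √(n : ℝ)) = a ^ 2 := by field_simp
      have h8 : b ^ 2 * σ ^ 2 / 2 * n = a ^ 2 / 2 := by
        rw [hb, mul_pow, hη, div_pow, mul_pow, hq2]; field_simp
      have h9 := mul_le_mul_of_nonneg_left h3 (show 0 ≤ a / (σ * √(n : ℝ)) by positivity)
      rw [h6, h8]
      linarith
    have hfin : P (R n) ≤ ENNReal.ofReal ((t : ℝ) ^ (-p)) := by
      refine (measure_mono hsub).trans (hmark.trans ?_)
      rw [Real.rpow_neg ht0.le, ENNReal.ofReal_inv_of_pos hpos, ← one_div]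
      exact ENNReal.div_le_div_right hsup _
    exact ENNReal.toReal_le_of_le_ofReal (Real.rpow_pos_of_pos ht0 _).le hfin
  have hcover : {ω | 1 ≤ (recordAfter σ α O₁ O₂ (x ω) (t - 1)).count i ∧
      (recordAfter σ α O₁ O₂ (x ω) (t - 1)).radius σ p t i <
        η * ((recordAfter σ α O₁ O₂ (x ω) (t - 1)).mean i - μ i)} ⊆
      ⋃ n ∈ Finset.Icc 1 (t - 1), R n := by
    rintro ω ⟨h1, h2⟩
    simp only [Set.mem_iUnion]
    exact ⟨_, Finset.mem_Icc.2 ⟨h1, recordAfter_count_le σ α O₁ O₂ (x ω) (t - 1) i⟩, rfl, h2⟩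
  calc _ ≤ P.real (⋃ n ∈ Finset.Icc 1 (t - 1), R n) := measureReal_mono hcover (measure_ne_top _ _)
    _ ≤ ∑ n ∈ Finset.Icc 1 (t - 1), P.real (R n) := measureReal_biUnion_finset_le _ _
    _ ≤ ∑ n ∈ Finset.Icc 1 (t - 1), (t : ℝ) ^ (-p) :=
        Finset.sum_le_sum fun n hn => hRle n (Finset.mem_Icc.1 hn).1
    _ = ((t - 1 : ℕ) : ℝ) * (t : ℝ) ^ (-p) := by simp
    _ ≤ t * (t : ℝ) ^ (-p) := by
        gcongr
        omega
    _ = (t : ℝ) ^ (1 - p) := by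
        rw [sub_eq_add_neg, Real.rpow_add ht0, Real.rpow_one]

/-- The probability that in round `t` the mean of some good deviates by more than the radius. -/
lemma measureReal_exists_deviation_le [IsProbabilityMeasure P] (hσ : 0 < σ)
    (hεm : ∀ t i, Measurable (ε t i))
    (hεsub : ∀ t i, HasSubgaussianMGF (ε t i) (Real.toNNReal (σ ^ 2)) P)
    (hεind : iIndepFun (fun t ω i => ε t i ω) P) (hO₁ : Measurable O₁)
    (hO₂ : ∀ φ, Measurable fun x => O₂ x φ) {η : ℝ} (hη : η ^ 2 = 1) {p : ℝ} (hp : 0 ≤ p)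
    {t : ℕ} (ht : N < t) :
    P.real {ω | ∃ i, (recordAfter σ α O₁ O₂ (fun s j => μ j + ε s j ω) (t - 1)).radius σ p t i <
        η * ((recordAfter σ α O₁ O₂ (fun s j => μ j + ε s j ω) (t - 1)).mean i - μ i)} ≤
      N * (t : ℝ) ^ (1 - p) := by
  refine (measureReal_mono (fun ω hω => ?_)).trans ((measureReal_iUnion_fintype_le
    fun i => {ω | 1 ≤ (recordAfter σ α O₁ O₂ (fun s j => μ j + ε s j ω) (t - 1)).count i ∧
      (recordAfter σ α O₁ O₂ (fun s j => μ j + ε s j ω) (t - 1)).radius σ p t i <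
        η * ((recordAfter σ α O₁ O₂ (fun s j => μ j + ε s j ω) (t - 1)).mean i - μ i)}).trans ?_)
  · obtain ⟨i, hi⟩ := hω
    exact Set.mem_iUnion.2 ⟨i, one_le_recordAfter_count σ α O₁ O₂ _ (by omega) i, hi⟩
  · refine (Finset.sum_le_sum fun i _ =>
      measureReal_noise_le hσ hεm hεsub hεind hO₁ hO₂ hη hp (by omega) i).trans_eq ?_
    simp

end Concentration

/-! ### Pathwise regret and its integrability. -/

section Regret

variable {K N : ℕ} {A : Fin K → Set (Finset (Fin N))}
  {r : Fin K → (Fin N → ℝ) → Finset (Fin N) → ℝ}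

open scoped Classical in
/-- Pathwise regret bound: the exploration rounds, the rounds in which an upper (`U`) or lower
(`V`) confidence bound fails, and the logarithmically many other suboptimal rounds. -/
lemma pathRegret_le (hK : 1 ≤ K) (hA : ∀ j, ∅ ∈ A j) {μ : Fin N → ℝ} {α p σ c Δmin Δmax : ℝ}
    (hp : 0 ≤ p) (hpα : p ≤ α) (hp4 : p ≤ 4) (hσ : 0 < σ) (hc : 0 < c) (hΔ : 0 < Δmin)
    (hr : LipschitzMonotone A r c) (hmin : MinGap A r μ Δmin) (hmax : MaxGap A r μ Δmax)
    {O₁ : (Fin N → ℝ) → Allocation A} (hO₁ : IsMaxMinOracle r O₁)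
    {O₂ : (Fin N → ℝ) → Allocation A → Fin K} (hO₂ : IsMinAgentOracle r O₂)
    (start : ℕ → Allocation A) (X : ℕ → Fin N → ℝ) (T : ℕ) {U V : ℕ → Prop}
    (hU : ∀ t, ¬ U t → ∀ i, -1 * ((recordAfter σ α O₁ O₂ X (t - 1)).mean i - μ i) ≤
      (recordAfter σ α O₁ O₂ X (t - 1)).radius σ α t i)
    (hV : ∀ t, ¬ V t → ∀ i, 1 * ((recordAfter σ α O₁ O₂ X (t - 1)).mean i - μ i) ≤
      (recordAfter σ α O₁ O₂ X (t - 1)).radius σ p t i) :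
    pathRegret σ α O₁ O₂ start r μ X T ≤ Δmax * (N +
      ∑ t ∈ Finset.Ioc N T, ((if U t then 1 else 0) + if V t then 1 else 0) +
      3 * N * ((√(2 * α) + 2) ^ 2 * c ^ 2 * (N : ℝ) ^ 2 * σ ^ 2 / Δmin ^ 2 * Real.log T)) := by
  have hΔ0 := maxGap_nonneg hK hA hmax
  set bad : ℕ → Prop := fun t =>
    duelingAllocation σ α O₁ O₂ start X t ∉ optimalAllocations A r μ with hbad
  set B := (Finset.Ioc N T).filter fun t => bad t ∧ ¬ U t ∧ ¬ V t with hB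
  have hBcard : (B.card : ℝ) ≤ 3 * N *
      ((√(2 * α) + 2) ^ 2 * c ^ 2 * (N : ℝ) ^ 2 * σ ^ 2 / Δmin ^ 2 * Real.log T) := by
    refine card_suboptimal_le hK hA hp hpα hp4 hσ hc hΔ hr hmin hO₁ hO₂ X
      (Finset.filter_subset _ _) (fun t ht i => ?_) (fun t ht i => ?_) (fun t ht => ?_)
    · have := hU t (Finset.mem_filter.1 ht).2.2.1 i
      simp only [Record.ucb]
      linarith
    · have := hV t (Finset.mem_filter.1 ht).2.2.2 i
      linarith
    · have h1 := (Finset.mem_filter.1 ht).2.1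
      have h2 := (Finset.mem_Ioc.1 (Finset.mem_filter.1 ht).1).1
      simpa only [hbad, duelingAllocation, chooseAllocation, if_neg (not_le.2 h2)] using h1
  have hround : ∀ t, optMaxMin A r μ - minReward r μ (duelingAllocation σ α O₁ O₂ start X t) ≤
      Δmax * if bad t then 1 else 0 := by
    intro t
    split_ifs with h
    · rw [mul_one]
      exact optMaxMin_sub_minReward_le hK hA hmax _
    · have h' : minReward r μ (duelingAllocation σ α O₁ O₂ start X t) = optMaxMin A r μ :=
        not_not.1 h
      rw [h', sub_self, mul_zero]
  have hcount : ∑ t ∈ Finset.Icc 1 T, (if bad t then (1 : ℝ) else 0) ≤ N +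
      ∑ t ∈ Finset.Ioc N T, ((if U t then 1 else 0) + if V t then 1 else 0) + B.card := by
    have hdisj : Disjoint (Finset.Icc 1 N) (Finset.Ioc N T) :=
      Finset.disjoint_left.2 fun t h1 h2 => by
        rw [Finset.mem_Icc] at h1
        rw [Finset.mem_Ioc] at h2
        omega
    calc ∑ t ∈ Finset.Icc 1 T, (if bad t then (1 : ℝ) else 0)
        ≤ ∑ t ∈ Finset.Icc 1 N ∪ Finset.Ioc N T, (if bad t then (1 : ℝ) else 0) := by
          refine Finset.sum_le_sum_of_subset_of_nonneg (fun t ht => ?_)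
            fun t _ _ => by split_ifs <;> norm_num
          rw [Finset.mem_Icc] at ht
          rw [Finset.mem_union, Finset.mem_Icc, Finset.mem_Ioc]
          omega
      _ = ∑ t ∈ Finset.Icc 1 N, (if bad t then (1 : ℝ) else 0) +
          ∑ t ∈ Finset.Ioc N T, (if bad t then (1 : ℝ) else 0) := Finset.sum_union hdisj
      _ ≤ ∑ t ∈ Finset.Icc 1 N, (1 : ℝ) + ∑ t ∈ Finset.Ioc N T,
          (((if U t then (1 : ℝ) else 0) + if V t then 1 else 0) +
            if bad t ∧ ¬ U t ∧ ¬ V t then 1 else 0) := by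
          refine add_le_add (Finset.sum_le_sum fun t _ => ?_) (Finset.sum_le_sum fun t _ => ?_)
          · split_ifs <;> norm_num
          · by_cases h1 : U t <;> by_cases h2 : V t <;> by_cases h3 : bad t <;>
              simp [h1, h2, h3]
      _ = _ := by
          rw [Finset.sum_add_distrib, hB, Finset.card_filter]
          push_cast
          simp [add_assoc]
  calc pathRegret σ α O₁ O₂ start r μ X T
      ≤ ∑ t ∈ Finset.Icc 1 T, Δmax * (if bad t then (1 : ℝ) else 0) :=
        Finset.sum_le_sum fun t _ => hround t
    _ = Δmax * ∑ t ∈ Finset.Icc 1 T, (if bad t then (1 : ℝ) else 0) := by rw [Finset.mul_sum]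
    _ ≤ _ := mul_le_mul_of_nonneg_left (hcount.trans (by linarith)) hΔ0

/-- The regret of a round is a function of the chosen allocation, a random element of a finite
discrete space. -/
lemma integrable_pathRegret {μ : Fin N → ℝ} {α σ : ℝ}
    {O₁ : (Fin N → ℝ) → Allocation A} (hO₁ : Measurable O₁)
    {O₂ : (Fin N → ℝ) → Allocation A → Fin K} (hO₂ : ∀ φ, Measurable fun x => O₂ x φ)
    (start : ℕ → Allocation A) {Ω : Type*} [MeasurableSpace Ω] (P : Measure Ω)
    [IsFiniteMeasure P] {x : Ω → ℕ → Fin N → ℝ} (hx : Measurable x) (T : ℕ) :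
    Integrable (fun ω => pathRegret σ α O₁ O₂ start r μ (x ω) T) P := by
  refine integrable_finsetSum _ fun t _ => ?_
  have h : Integrable (fun φ : Allocation A => optMaxMin A r μ - minReward r μ φ)
      (P.map fun ω => duelingAllocation σ α O₁ O₂ start (x ω) t) := Integrable.of_finite
  exact h.comp_measurable ((measurable_duelingAllocation hO₁ hO₂ start t).comp hx)

end Regret

end BundleBandit

/-! ### The bound on the expected regret. -/

theorem theorem3 {K N : ℕ} (hK : 1 ≤ K)
    (A : Fin K → Set (Finset (Fin N))) (hA : ∀ j, ∅ ∈ A j)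
    (r : Fin K → (Fin N → ℝ) → Finset (Fin N) → ℝ) (μ : Fin N → ℝ)
    (α σ c Δmin Δmax : ℝ) (hα : 2 < α) (hσ : 0 < σ) (hc : 0 < c) (hΔ : 0 < Δmin)
    (hr : LipschitzMonotone A r c)
    (hmin : MinGap A r μ Δmin) (hmax : MaxGap A r μ Δmax)
    (O₁ : (Fin N → ℝ) → Allocation A) (hO₁ : IsMaxMinOracle r O₁) (hO₁m : Measurable O₁)
    (O₂ : (Fin N → ℝ) → Allocation A → Fin K) (hO₂ : IsMinAgentOracle r O₂)
    (hO₂m : ∀ φ, Measurable fun x => O₂ x φ)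
    (start : ℕ → Allocation A)
    {Ω : Type*} [MeasurableSpace Ω] (P : Measure Ω) [IsProbabilityMeasure P]
    (ε : ℕ → Fin N → Ω → ℝ) (hεm : ∀ t i, Measurable (ε t i))
    (hεsub : ∀ t i, HasSubgaussianMGF (ε t i) (Real.toNNReal (σ ^ 2)) P)
    (hεind : iIndepFun (fun t ω i => ε t i ω) P)
    (T : ℕ) :
    Integrable (fun ω => pathRegret σ α O₁ O₂ start r μ (fun t i => μ i + ε t i ω) T) P ∧
    ∫ ω, pathRegret σ α O₁ O₂ start r μ (fun t i => μ i + ε t i ω) T ∂P ≤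
      3 * Δmax * N * ((√(2 * α) + 2) ^ 2 * c ^ 2 * (N : ℝ) ^ 2 * σ ^ 2 / Δmin ^ 2 * Real.log T
        + (α - 1) / (α - 2) + 2) := by
  classical
  set x : Ω → ℕ → Fin N → ℝ := fun ω t i => μ i + ε t i ω with hx
  have hxm : Measurable x := measurable_pi_lambda _ fun s => measurable_pi_lambda _ fun j =>
    (hεm s j).const_add _
  have hint := integrable_pathRegret (r := r) (μ := μ) (α := α) (σ := σ) hO₁m hO₂m start P hxm T
  refine ⟨hint, ?_⟩
  have hΔ0 := maxGap_nonneg hK hA hmax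
  -- Exponent for upward deviations of the means: above `2` for summability, at most `α` so that the
  -- lower confidence bounds still hold, at most `4` for the constant.
  set p := min α 4 with hp
  have hp2 : 2 < p := lt_min hα (by norm_num)
  set dev : ℝ → ℝ → ℕ → Set Ω := fun η q t =>
    {ω | ∃ i, (recordAfter σ α O₁ O₂ (x ω) (t - 1)).radius σ q t i <
      η * ((recordAfter σ α O₁ O₂ (x ω) (t - 1)).mean i - μ i)} with hdev
  have hdevm : ∀ η q t, MeasurableSet (dev η q t) := fun η q t => by
    have hrec := measurable_recordAfter (σ := σ) (α := α) hO₁m hO₂m (t - 1)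
    have hrec1 := fun i => (hrec.1 i).comp hxm
    have hrec2 := fun i => (hrec.2 i).comp hxm
    simp only [hdev, Set.ofPred_exists]
    exact MeasurableSet.iUnion fun i => measurableSet_lt (measurable_radius hrec1 q t i)
      (((measurable_mean hrec1 hrec2 i).sub_const _).const_mul _)
  have hdevp : ∀ η q, η ^ 2 = 1 → 2 < q →
      ∑ t ∈ Finset.Ioc N T, P.real (dev η q t) ≤ N * (1 / (q - 2)) := fun η q hη hq => by
    refine (Finset.sum_le_sum fun t ht => measureReal_exists_deviation_le hσ hεm hεsub hεind
      hO₁m hO₂m hη (by linarith) (Finset.mem_Ioc.1 ht).1).trans ?_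
    rw [← Finset.mul_sum]
    -- For `N = 0` the sum would include `t = 1`, but the factor `N` vanishes.
    rcases Nat.eq_zero_or_pos N with h | h
    · simp [h]
    · exact mul_le_mul_of_nonneg_left (sum_rpow_le hq h T) (Nat.cast_nonneg N)
  have hind : ∀ η q t, Integrable ((dev η q t).indicator (1 : Ω → ℝ)) P := fun η q t =>
    (integrable_const (1 : ℝ)).indicator (hdevm η q t)
  set C := 3 * N * ((√(2 * α) + 2) ^ 2 * c ^ 2 * (N : ℝ) ^ 2 * σ ^ 2 / Δmin ^ 2 * Real.log T)
    with hC
  have hpath : ∀ ω, pathRegret σ α O₁ O₂ start r μ (x ω) T ≤ Δmax * (N +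
      ∑ t ∈ Finset.Ioc N T, ((dev (-1) α t).indicator (1 : Ω → ℝ) ω +
        (dev 1 p t).indicator (1 : Ω → ℝ) ω) + C) := fun ω => by
    have h := pathRegret_le hK hA (by linarith) (min_le_left α 4) (min_le_right α 4) hσ hc hΔ hr
      hmin hmax hO₁ hO₂ start (x ω) T (U := fun t => ω ∈ dev (-1) α t)
      (V := fun t => ω ∈ dev 1 p t) (fun t ht i => not_lt.1 fun hlt => ht ⟨i, hlt⟩)
      (fun t ht i => not_lt.1 fun hlt => ht ⟨i, hlt⟩)
    simp only [Set.indicator, Pi.one_apply]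
    convert h
  have hadd : ∀ t ∈ Finset.Ioc N T, Integrable (fun ω => (dev (-1) α t).indicator (1 : Ω → ℝ) ω +
      (dev 1 p t).indicator (1 : Ω → ℝ) ω) P := fun t _ => (hind (-1) α t).add (hind 1 p t)
  have hsumint : Integrable (fun ω => ∑ t ∈ Finset.Ioc N T,
      ((dev (-1) α t).indicator (1 : Ω → ℝ) ω + (dev 1 p t).indicator (1 : Ω → ℝ) ω)) P :=
    integrable_finsetSum _ hadd
  have haddsum : Integrable (fun ω => (N : ℝ) + ∑ t ∈ Finset.Ioc N T,
      ((dev (-1) α t).indicator (1 : Ω → ℝ) ω + (dev 1 p t).indicator (1 : Ω → ℝ) ω)) P :=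
    (integrable_const _).add hsumint
  have hsum : ∫ ω, ∑ t ∈ Finset.Ioc N T, ((dev (-1) α t).indicator (1 : Ω → ℝ) ω +
      (dev 1 p t).indicator (1 : Ω → ℝ) ω) ∂P ≤ N * (1 / (α - 2)) + N * (1 / (p - 2)) := by
    rw [integral_finsetSum _ hadd]
    simp_rw [integral_add (hind _ _ _) (hind _ _ _), integral_indicator_one (hdevm _ _ _),
      Finset.sum_add_distrib]
    exact add_le_add (hdevp _ _ (by norm_num) hα) (hdevp _ _ (by norm_num) hp2)
  have hα2 : 0 < α - 2 := by linarith
  have hfrac : (α - 1) / (α - 2) = 1 / (α - 2) + 1 := by field_simp; ring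
  -- If the cap is active, the left side is `1 / 2`; so capping costs at most an additive constant.
  have hpfrac : 1 / (p - 2) ≤ 1 / (α - 2) + 1 := by
    rcases min_choice α 4 with h | h
    · rw [hp, h]
      linarith
    · rw [hp, h]
      have : 0 < 1 / (α - 2) := by positivity
      linarith
  have hα3 : 0 < 1 / (α - 2) := by positivity
  calc ∫ ω, pathRegret σ α O₁ O₂ start r μ (x ω) T ∂P
      ≤ ∫ ω, Δmax * (N + ∑ t ∈ Finset.Ioc N T, ((dev (-1) α t).indicator (1 : Ω → ℝ) ω +
        (dev 1 p t).indicator (1 : Ω → ℝ) ω) + C) ∂P :=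
        integral_mono hint ((haddsum.add (integrable_const _)).const_mul _) hpath
    _ = Δmax * (N + ∫ ω, ∑ t ∈ Finset.Ioc N T, ((dev (-1) α t).indicator (1 : Ω → ℝ) ω +
        (dev 1 p t).indicator (1 : Ω → ℝ) ω) ∂P + C) := by
        rw [integral_const_mul, integral_add haddsum (integrable_const _),
          integral_add (integrable_const _) hsumint]
        simp
    _ ≤ Δmax * (3 * N * ((α - 1) / (α - 2) + 2) + C) := by
        refine mul_le_mul_of_nonneg_left ?_ hΔ0
        have hN : (0 : ℝ) ≤ N := Nat.cast_nonneg N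
        rw [hfrac]
        nlinarith
    _ = _ := by rw [hC]; ring
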